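/- A *quasitopos* is a category $\mathcal C$ with finite limits and finite colimits such that $\mathcal C$ and each of its slice categories $\mathcal C/C$ is cartesian closed, and which has a weak subobject classifier, that is, a morphism $t\colon 1\to\Omega$ such that for every strong monomorphism $m\colon X\to Y$ there is a unique $f\colon Y\to\Omega$ for which $m$ is the pullback of $t$ along $f$. Let $\mathcal S$ be a quasitopos and let $\mathcal E$ be a full reflective subcategory of $\mathcal S$, with reflection $L\colon\mathcal S\to\mathcal E$ (the left adjoint of the inclusion) and unit $\ell\colon 1\to L$. We say that - $L$ is *semi-left-exact* if, for every $X\in\mathcal S$, every $A\in\mathcal E$ and every $u\colon A\to LX$, it preserves the pullback of $\ell_X\colon X\to LX$ along $u$; - $L$ has *stable units* if it preserves all pullbacks in $\mathcal S$ of cospans $X\to B\leftarrow Y$ with $B\in\mathcal E$; - $L$ is *quasi-lex* if for each finite diagram $X\colon\mathcal D\to\mathcal S$ the canonical comparison $L(\lim X)\to\lim (LX)$ in $\mathcal E$ is both a monomorphism and an epimorphism. Then: 1. If $L$ is semi-left-exact and quasi-lex, then $\mathcal E$ is a quasitopos. 2. If $L$ is semi-left-exact and preserves finite products and monomorphisms,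 then $L$ is quasi-lex, and hence $\mathcal E$ is a quasitopos. 3. If $L$ has stable units and preserves monomorphisms, then $L$ is semi-left-exact and quasi-lex, and hence $\mathcal E$ is a quasitopos. -/

import Mathlib

open CategoryTheory CategoryTheory.Limits

universe v₁ v₂ u₁ u₂

namespace QuasitoposReflection

/-- A category is cartesian closed: it has finite products, and every functor `A × -` has a right
adjoint. -/
def IsCartesianClosed (C : Type u₁) [Category.{v₁} C] : Prop :=
  ∃ _ : CartesianMonoidalCategory C, Nonempty (MonoidalClosed C)

/-- A morphism `t : T ⟶ Ω` with `T` terminal is a weak subobject classifier if every strong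
monomorphism is a pullback of `t` along a unique morphism. -/
structure IsWeakSubobjectClassifier {C : Type u₁} [Category.{v₁} C] {T Ω : C} (t : T ⟶ Ω) :
    Prop where
  isTerminal : Nonempty (IsTerminal T)
  existsUnique : ∀ {X Y : C} (m : X ⟶ Y) [StrongMono m],
    ∃! f : Y ⟶ Ω, ∃ g : X ⟶ T, IsPullback m g f t

/-- A quasitopos: a category with finite limits and finite colimits which is cartesian closed, whose
slices are all cartesian closed, and which has a classifier for strong subobjects. -/
structure IsQuasitopos (C : Type u₁) [Category.{v₁} C] : Prop where
  hasFiniteLimits : HasFiniteLimits C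
  hasFiniteColimits : HasFiniteColimits C
  cartesianClosed : IsCartesianClosed C
  cartesianClosed_over : ∀ X : C, IsCartesianClosed (Over X)
  exists_classifier : ∃ (T Ω : C) (t : T ⟶ Ω), IsWeakSubobjectClassifier t

section Reflection

variable {S : Type u₁} [Category.{v₁} S] {E : Type u₂} [Category.{v₂} E]

/-- The reflection `L ⊣ i` is semi-left-exact: `L` preserves the pullback of each unit component
`X ⟶ i (L X)` along each morphism `i A ⟶ i (L X)` whose domain lies in the subcategory. -/
def IsSemiLeftExact {L : S ⥤ E} {i : E ⥤ S} (adj : L ⊣ i) : Prop :=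
  ∀ (X : S) (A : E) (u : i.obj A ⟶ i.obj (L.obj X)),
    PreservesLimit (cospan (adj.unit.app X) u) L

/-- The reflection `L ⊣ i` has stable units: `L` preserves all pullbacks over objects of the
subcategory. -/
def HasStableUnits {L : S ⥤ E} {i : E ⥤ S} (_adj : L ⊣ i) : Prop :=
  ∀ (B : E) (X Y : S) (f : X ⟶ i.obj B) (g : Y ⟶ i.obj B), PreservesLimit (cospan f g) L

/-- `L` is quasi-lex: for each finite diagram `X` the canonical comparison `L (lim X) ⟶ lim (L X)`
is both a monomorphism and an epimorphism. -/
def IsQuasiLex (L : S ⥤ E) : Prop :=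
  ∀ (D : Type) [SmallCategory D] [FinCategory D] (X : D ⥤ S)
    (c : Cone X) (_ : IsLimit c) (d : Cone (X ⋙ L)) (hd : IsLimit d),
    Mono (hd.lift (L.mapCone c)) ∧ Epi (hd.lift (L.mapCone c))

end Reflection

end QuasitoposReflection

/-! Exponentials: for `Y` an exponential of objects of `E`, computed in `S`, the product of the base
with the unit of `Y` is a pullback of that unit along a projection between objects of `E`.
Semi-left-exactness makes `L` invert it, so evaluation extends along it and splits the unit; thus
`Y` lies in `E`. The same argument works in slices.

Classifier: an epi–strong mono factorization of `L.map t` yields a closure of `t`, classified by an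
endomorphism `j` of `Ω`. Quasi-lexness and pullback-stability of epimorphisms in `E` show that
classifying maps of closed monomorphisms are fixed by `j`. The equalizer of `j` with the identity
then lies in `E` and classifies there.

Quasi-lexness from products and monomorphisms: a finite limit embeds in a product, which makes the
comparison monic. For epicness, semi-left-exactness realizes the limit in `E` as the reflection of
an object of `S`, and the limit in `S` covers it through an equalizer of two maps identified by `L`.
Such an equalizer is a pullback of the diagonal into the kernel pair of a unit; `L` inverts this
diagonal, and pullback preserves its cokernel pair (`exists_desc_pullback_cokernelPair`), so `L`
sends the equalizer to an epimorphism. With stable units, finite products are preserved as pullbacks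
over the terminal object. -/

namespace QuasitoposReflection

/-! ### Cokernel pairs and epimorphisms in locally cartesian closed categories -/

section LocallyCartesianClosed

variable {C : Type u₁} [Category.{v₁} C]

open MonoidalCategory CartesianMonoidalCategory MonoidalClosed in
/-- Pullback along `f` preserves cokernel pairs, as soon as the slice over the base is cartesian
closed: a pair of morphisms out of `P` that agree on the pullback of `δ` along `f` is induced by a
morphism out of the pullback of the cokernel pair of `δ`. -/
lemma exists_desc_pullback_cokernelPair [HasBinaryProducts C] {R : C}
    (hR : IsCartesianClosed (Over R))
    {Q K P D N Z : C} {δ : Q ⟶ R} {inl inr : R ⟶ K} (hK : IsPushout δ δ inl inr)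
    {κ : K ⟶ R} (hl : inl ≫ κ = 𝟙 R) (hr : inr ≫ κ = 𝟙 R)
    {f : P ⟶ R} {d : D ⟶ P} {q : D ⟶ Q} (hD : IsPullback d q f δ)
    {p : N ⟶ P} {k : N ⟶ K} (hN : IsPullback p k f κ)
    {n₁ n₂ : P ⟶ N} (hn₁p : n₁ ≫ p = 𝟙 P) (hn₁k : n₁ ≫ k = f ≫ inl)
    (hn₂p : n₂ ≫ p = 𝟙 P) (hn₂k : n₂ ≫ k = f ≫ inr)
    (u v : P ⟶ Z) (huv : d ≫ u = d ≫ v) :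
    ∃ h : N ⟶ Z, n₁ ≫ h = u ∧ n₂ ≫ h = v := by
  obtain ⟨_, ⟨_⟩⟩ := hR
  let A : Over R := Over.mk (prod.snd : Z ⨯ R ⟶ R)
  let P' : Over R := Over.mk f
  let I : Over R := Over.mk (𝟙 R)
  let K' : Over R := Over.mk κ
  let Q' : Over R := Over.mk δ
  let δ' : Q' ⟶ I := Over.homMk δ (by simp [Q', I])
  let il : I ⟶ K' := Over.homMk inl (by simp [I, K', hl])
  let ir : I ⟶ K' := Over.homMk inr (by simp [I, K', hr])
  let toA (w : P ⟶ Z) : P' ⟶ A := Over.homMk (prod.lift w f) (by exact prod.lift_snd _ _)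
  -- A morphism `P ⟶ Z` is a global point of the exponential of `A` by `P'` in the slice, and
  -- agreement on `D` becomes agreement of these points on `Q'`.
  let c (w : P ⟶ Z) : I ⟶ (ihom P').obj A := curry (fst P' I ≫ toA w)
  have hc : δ ≫ (c u).left = δ ≫ (c v).left := by
    have : δ' ≫ c u = δ' ≫ c v := by
      rw [← curry_natural_left, ← curry_natural_left]
      congr 1
      simp only [whiskerLeft_fst_assoc]
      ext : 1
      have e : (fst P' Q').left ≫ f = (snd P' Q').left ≫ δ :=
        (Over.w (fst P' Q')).trans (Over.w (snd P' Q')).symm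
      have e' : hD.lift _ _ e ≫ d = (fst P' Q').left := hD.lift_fst _ _ _
      change (fst P' Q').left ≫ prod.lift u f = (fst P' Q').left ≫ prod.lift v f
      apply Limits.prod.hom_ext
      · rw [Category.assoc, Category.assoc, prod.lift_fst, prod.lift_fst, ← e', Category.assoc,
          Category.assoc, huv]
      · rw [Category.assoc, Category.assoc, prod.lift_snd, prod.lift_snd]
    exact congrArg CommaMorphism.left this
  let w : K' ⟶ (ihom P').obj A := Over.homMk (hK.desc (c u).left (c v).left hc) (by
    apply hK.hom_ext
    · rw [hK.inl_desc_assoc]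
      exact (Over.w (c u)).trans hl.symm
    · rw [hK.inr_desc_assoc]
      exact (Over.w (c v)).trans hr.symm)
  have hlw : il ≫ w = c u := by
    ext : 1
    exact hK.inl_desc _ _ _
  have hrw : ir ≫ w = c v := by
    ext : 1
    exact hK.inr_desc _ _ _
  let N' : Over R := Over.mk (p ≫ f)
  let s : N' ⟶ P' ⊗ K' := lift (Over.homMk p) (Over.homMk k (by simp [N', K', hN.w]))
  let h' : N' ⟶ A := s ≫ uncurry w
  have key (n : P ⟶ N) (hn : n ≫ p = 𝟙 P) (i' : I ⟶ K') (hi : n ≫ k = f ≫ i'.left)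
      (x : P ⟶ Z) (hx : i' ≫ w = c x) : n ≫ h'.left ≫ prod.fst = x := by
    let n' : P' ⟶ N' := Over.homMk n (by simp [N', P', reassoc_of% hn])
    let f' : P' ⟶ I := Over.homMk f (by simp [I, P'])
    have : n' ≫ h' = toA x := by
      have e : n' ≫ s = lift (𝟙 P') f' ≫ P' ◁ i' := by
        ext : 2
        · simp only [Category.assoc, s, lift_fst, whiskerLeft_fst]
          exact hn
        · simp only [Category.assoc, s, lift_snd, whiskerLeft_snd, lift_snd_assoc]
          exact hi
      calc n' ≫ h' = lift (𝟙 P') f' ≫ P' ◁ i' ≫ uncurry w := by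
            simp only [h', reassoc_of% e]
        _ = toA x := by
            rw [← uncurry_natural_left, hx, uncurry_curry, lift_fst_assoc, Category.id_comp]
    have e := congrArg (fun g : P' ⟶ A ↦ g.left ≫ prod.fst) this
    refine (Category.assoc _ _ _).symm.trans (e.trans ?_)
    exact prod.lift_fst _ _
  exact ⟨h'.left ≫ prod.fst, key n₁ hn₁p il hn₁k u hlw, key n₂ hn₂p ir hn₂k v hrw⟩

/-- If the cokernel pair of `δ` becomes trivial after pullback along `f`, then the pullback of `δ`
along `f` is an epimorphism. -/
lemma epi_of_isPullback_of_isPushout [HasPullbacks C] [HasBinaryProducts C] {R : C}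
    (hR : IsCartesianClosed (Over R)) {Q K P D : C} {δ : Q ⟶ R} {inl inr : R ⟶ K}
    (hK : IsPushout δ δ inl inr) {f : P ⟶ R} {d : D ⟶ P} {q : D ⟶ Q} (hD : IsPullback d q f δ)
    (hf : f ≫ inl = f ≫ inr) : Epi d where
  left_cancellation u v huv := by
    let κ : K ⟶ R := hK.desc (𝟙 R) (𝟙 R) rfl
    have hl : inl ≫ κ = 𝟙 R := hK.inl_desc _ _ _
    have hr : inr ≫ κ = 𝟙 R := hK.inr_desc _ _ _
    have hN := IsPullback.of_hasPullback f κ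
    -- By `hf` the two sections of the pulled-back cokernel pair coincide, so both composites with
    -- `h` agree.
    obtain ⟨h, rfl, rfl⟩ := exists_desc_pullback_cokernelPair hR hK hl hr hD hN
      (n₁ := hN.lift (𝟙 P) (f ≫ inl) (by simp [hl])) (n₂ := hN.lift (𝟙 P) (f ≫ inr) (by simp [hr]))
      (by simp) (by simp) (by simp) (by simp) u v huv
    congr 1
    apply hN.hom_ext <;> simp [hf]

/-- The two legs of the cokernel pair of an epimorphism are equal, so the preceding criterion
applies to any `f`. -/
lemma epi_fst_of_isPullback [HasFiniteLimits C] (hC : ∀ X : C, IsCartesianClosed (Over X))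
    {A B P X : C} {d : P ⟶ X} {q : P ⟶ A} {f : X ⟶ B} {e : A ⟶ B}
    (h : IsPullback d q f e) [Epi e] : Epi d := by
  have hK := IsPushout.of_hasPushout e e
  refine epi_of_isPullback_of_isPushout (hC B) hK h ?_
  rw [(cancel_epi e).1 hK.w]

/-- In a locally cartesian closed category with finite limits and colimits, every morphism is an
epimorphism followed by a strong monomorphism. -/
lemma exists_epi_strongMono_fac [HasFiniteLimits C] [HasPushouts C]
    (hC : ∀ X : C, IsCartesianClosed (Over X)) {X Y : C} (f : X ⟶ Y) :
    ∃ (I : C) (e : X ⟶ I) (m : I ⟶ Y), Epi e ∧ StrongMono m ∧ e ≫ m = f := by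
  have hK := IsPushout.of_hasPushout f f
  let m := equalizer.ι (pushout.inl f f) (pushout.inr f f)
  let e : X ⟶ equalizer (pushout.inl f f) (pushout.inr f f) := equalizer.lift f hK.w
  have hem : e ≫ m = f := equalizer.lift_ι _ _
  refine ⟨_, e, m, ?_, inferInstance, hem⟩
  -- Since `m` is monic, `e` is the pullback of `f` along `m`, and `m` equalizes the cokernel pair
  -- of `f`.
  refine epi_of_isPullback_of_isPushout (hC Y) hK (f := m) (q := 𝟙 X) ?_
    (equalizer.condition _ _)
  refine ⟨⟨by rw [hem, Category.id_comp]⟩, ⟨PullbackCone.IsLimit.mk _ (fun s ↦ s.snd) ?_ ?_ ?_⟩⟩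
  · intro s
    rw [← cancel_mono m, Category.assoc, hem, s.condition]
  · intro s
    simp
  · intro s l _ h
    simpa using h

end LocallyCartesianClosed

/-! ### Exponentials in the subcategory and its slices -/

section ExponentialTransfer

variable {S : Type u₁} [Category.{v₁} S] {E : Type u₂} [Category.{v₂} E]
  {L : S ⥤ E} {i : E ⥤ S}

lemma exists_fac_of_isIso_map (adj : L ⊣ i) {P Q : S} (p : P ⟶ Q) [IsIso (L.map p)] {B : E}
    (g : P ⟶ i.obj B) : ∃ g' : Q ⟶ i.obj B, p ≫ g' = g :=
  ⟨adj.homEquiv _ _ (inv (L.map p) ≫ (adj.homEquiv _ _).symm g), by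
    simp [← Adjunction.homEquiv_naturality_left]⟩

lemma isIso_unit_of_retraction [i.Full] [i.Faithful] (adj : L ⊣ i) {Y : S}
    (r : i.obj (L.obj Y) ⟶ Y) (hr : adj.unit.app Y ≫ r = 𝟙 Y) : IsIso (adj.unit.app Y) := by
  let _ : Reflective i := ⟨L, adj⟩
  have : IsSplitMono ((reflectorAdjunction i).unit.app Y) := .mk' ⟨r, hr⟩
  exact Functor.essImage.unit_isIso (mem_essImage_of_unit_isSplitMono (i := i) (A := Y))

/-- `L` inverts units, by a triangle identity and invertibility of the counit, hence also any
pullback of a unit that it preserves. -/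
lemma IsSemiLeftExact.isIso_map {adj : L ⊣ i} [i.Full] [i.Faithful] (h : IsSemiLeftExact adj)
    {X P : S} {A : E} {p : P ⟶ i.obj A} {q : P ⟶ X} {u : i.obj A ⟶ i.obj (L.obj X)}
    (hP : IsPullback p q u (adj.unit.app X)) : IsIso (L.map p) := by
  have := h X A u
  have : IsIso (L.map (adj.unit.app X)) := by
    have : IsIso (L.map (adj.unit.app X) ≫ adj.counit.app (L.obj X)) := by
      exact (adj.left_triangle_components X).symm ▸ inferInstanceAs (IsIso (𝟙 (L.obj X)))
    exact IsIso.of_isIso_comp_right _ (adj.counit.app (L.obj X))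
  exact (hP.flip.map L).isIso_snd_of_isIso

open MonoidalCategory CartesianMonoidalCategory MonoidalClosed in
/-- A reflective subcategory of a cartesian closed category is cartesian closed if the reflection
inverts the pullbacks of unit components along morphisms from objects of the subcategory. -/
lemma isCartesianClosed_of_reflective [i.Full] [i.Faithful] (adj : L ⊣ i) [HasFiniteProducts E]
    (hS : IsCartesianClosed S)
    (h : ∀ {X P : S} {A : E} {p : P ⟶ i.obj A} {q : P ⟶ X} {u : i.obj A ⟶ i.obj (L.obj X)},
      IsPullback p q u (adj.unit.app X) → IsIso (L.map p)) : IsCartesianClosed E := by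
  obtain ⟨_, ⟨_⟩⟩ := hS
  let _ : CartesianMonoidalCategory E := .ofHasFiniteProducts
  let _ : Reflective i := ⟨L, adj⟩
  have := adj.rightAdjoint_preservesLimits
  have : PreservesFiniteProducts i := inferInstance
  let _ : i.Monoidal := .ofChosenFiniteProducts i
  have hU (A B : E) : IsIso (adj.unit.app ((ihom (i.obj A)).obj (i.obj B))) := by
    let Y := (ihom (i.obj A)).obj (i.obj B)
    let φ := Functor.Monoidal.μIso i A (L.obj Y)
    -- Up to `φ`, this is the pullback of the unit of `Y` along the second projection.
    let p : i.obj A ⊗ Y ⟶ i.obj (A ⊗ L.obj Y) := i.obj A ◁ adj.unit.app Y ≫ φ.hom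
    have hp : IsPullback p (snd _ _) (φ.inv ≫ snd _ _) (adj.unit.app Y) := by
      refine ⟨⟨by simp [p]⟩, ⟨PullbackCone.IsLimit.mk _
        (fun s ↦ lift (s.fst ≫ φ.inv ≫ fst _ _) s.snd) (fun s ↦ ?_) (fun s ↦ ?_) ?_⟩⟩
      · rw [← cancel_mono φ.inv]
        ext
        · simp [p]
        · simpa [p] using s.condition.symm
      · simp
      · intro s m h₁ h₂
        ext
        · simp [← h₁, p]
        · simpa using h₂
    have := h hp
    -- Evaluation extends along `p`; the transpose of the extension retracts the unit of `Y`.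
    obtain ⟨g, hg⟩ := exists_fac_of_isIso_map adj p ((ihom.ev (i.obj A)).app (i.obj B))
    refine isIso_unit_of_retraction adj (curry (φ.hom ≫ g)) ?_
    rw [← curry_natural_left, curry_eq_iff, uncurry_id_eq_ev, ← hg, Category.assoc]
  have : MonoidalClosed E :=
    { closed := fun A ↦
      { rightAdj := i ⋙ ihom (i.obj A) ⋙ L
        adj := (ihom.adjunction (i.obj A)).restrictFullyFaithful (.ofFullyFaithful i)
          (.ofFullyFaithful i) (Functor.Monoidal.commTensorLeft i A)
          (NatIso.ofComponents (fun B ↦ asIso (adj.unit.app ((ihom (i.obj A)).obj (i.obj B))))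
            (fun f ↦ adj.unit.naturality _)) } }
  exact ⟨_, ⟨this⟩⟩

lemma isCartesianClosed_over_of_reflective [i.Full] [i.Faithful] (adj : L ⊣ i) [HasFiniteLimits E]
    (h : IsSemiLeftExact adj) (A : E) (hS : IsCartesianClosed (Over (i.obj A))) :
    IsCartesianClosed (Over A) := by
  have := Over.ConstructProducts.over_finiteProducts_of_finiteWidePullbacks (B := A)
  refine isCartesianClosed_of_reflective (Over.postAdjunctionRight (Y := A) adj) hS ?_
  intro X P B p q u hP
  have hP' := hP.map (Over.forget _)
  have : IsIso (L.map p.left) := h.isIso_map (X := X.left) (A := B.left) (q := q.left)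
    (u := u.left) hP'
  have : IsIso ((Over.forget A).map ((Over.post L ⋙ Over.map (adj.counit.app A)).map p)) := this
  exact isIso_of_reflects_iso _ (Over.forget A)

end ExponentialTransfer

/-! ### Strong subobjects, closure and the classifier -/

lemma strongMono_of_isPullback {C : Type u₁} [Category.{v₁} C] {P A B X : C} {m' : P ⟶ X}
    {q : P ⟶ A} {f : X ⟶ B} {m : A ⟶ B} (h : IsPullback m' q f m) [StrongMono m] :
    StrongMono m' where
  mono := ⟨fun a b hab ↦ h.hom_ext hab ((cancel_mono m).1 (by
    simp only [Category.assoc, ← h.w, reassoc_of% hab]))⟩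
  rlp {U V} z hz := ⟨fun {a b} sq ↦ by
    have sq' : CommSq (a ≫ q) z m (b ≫ f) := ⟨by
      rw [Category.assoc, ← h.w, reassoc_of% sq.w]⟩
    refine ⟨⟨h.lift b sq'.lift (by simp), h.hom_ext ?_ ?_, by simp⟩⟩
    · simp [sq.w]
    · simp⟩

section Classifier

variable {S : Type u₁} [Category.{v₁} S] {E : Type u₂} [Category.{v₂} E]
  {L : S ⥤ E} {i : E ⥤ S}

lemma strongMono_map_of_adjunction (adj : L ⊣ i) {A B : E} (m : A ⟶ B) [StrongMono m] :
    StrongMono (i.map m) where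
  mono := by
    have := i.preservesMonomorphisms_of_adjunction adj
    infer_instance
  rlp {_ _} z _ := by
    have := L.preservesEpimorphisms_of_adjunction adj
    rw [← adj.hasLiftingProperty_iff]
    infer_instance

/-- The reflection of a pullback of a cospan with limit cone `P` compares epimorphically with the
pullback of the reflections, if the reflection is quasi-lex. -/
lemma IsQuasiLex.epi_lift (h : IsQuasiLex L) {P X Y B : S} {p : P ⟶ X} {q : P ⟶ Y} {f : X ⟶ B}
    {g : Y ⟶ B} (hP : IsPullback p q f g) {P' : E} {p' : P' ⟶ L.obj X} {q' : P' ⟶ L.obj Y}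
    (hP' : IsPullback p' q' (L.map f) (L.map g)) (k : L.obj P ⟶ P') (hk₁ : k ≫ p' = L.map p)
    (hk₂ : k ≫ q' = L.map q) : Epi k := by
  let d := PullbackCone.mk p' q' hP'.w
  let hd := (IsLimit.postcomposeInvEquiv (cospanCompIso L f g) d).symm hP'.isLimit
  have := (h _ _ _ hP.isLimit _ hd).2
  have e : hd.lift (L.mapCone hP.cone) = k := ?_
  · exact e ▸ this
  apply hP'.hom_ext
  · exact (congrArg (hd.lift (L.mapCone hP.cone) ≫ ·) (Category.comp_id p').symm).trans
      ((hd.fac (L.mapCone hP.cone) WalkingCospan.left).trans hk₁.symm)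
  · exact (congrArg (hd.lift (L.mapCone hP.cone) ≫ ·) (Category.comp_id q').symm).trans
      ((hd.fac (L.mapCone hP.cone) WalkingCospan.right).trans hk₂.symm)

/-- A morphism of the ambient category is a closed monomorphism if it is the pullback, along a unit
component, of a strong monomorphism of the subcategory. -/
def IsClosedMono (adj : L ⊣ i) {X Y : S} (m : X ⟶ Y) : Prop :=
  ∃ (C : E) (n : C ⟶ L.obj Y) (a : X ⟶ i.obj C),
    StrongMono n ∧ IsPullback m a (adj.unit.app Y) (i.map n)

namespace IsClosedMono

variable {adj : L ⊣ i}

lemma strongMono {X Y : S} {m : X ⟶ Y} (h : IsClosedMono adj m) : StrongMono m := by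
  obtain ⟨C, n, a, _, h⟩ := h
  have := strongMono_map_of_adjunction adj n
  exact strongMono_of_isPullback h

/-- By naturality of the unit, pulling back along `f` amounts to pulling back the strong
monomorphism of `E` along `L.map f`. -/
lemma of_isPullback [HasPullbacks E] {X Y X' Y' : S} {m' : X' ⟶ Y'} {q : X' ⟶ X} {f : Y' ⟶ Y}
    {m : X ⟶ Y} (h : IsPullback m' q f m) (hm : IsClosedMono adj m) : IsClosedMono adj m' := by
  obtain ⟨C, n, a, _, hn⟩ := hm
  have := adj.rightAdjoint_preservesLimits
  have hC := IsPullback.of_hasPullback (L.map f) n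
  have h₂ := h.paste_vert hn
  have e : f ≫ adj.unit.app Y = adj.unit.app Y' ≫ i.map (L.map f) := adj.unit.naturality f
  have hCi := hC.map i
  let l : X' ⟶ i.obj (pullback (L.map f) n) := hCi.lift (m' ≫ adj.unit.app Y') (q ≫ a) (by
    rw [Category.assoc, ← e, h₂.w])
  refine ⟨_, pullback.fst (L.map f) n, l, strongMono_of_isPullback hC, ?_⟩
  refine IsPullback.of_bot ?_ ?_ hCi
  · have hl : l ≫ i.map (pullback.snd (L.map f) n) = q ≫ a := hCi.lift_snd _ _ _
    rw [← e, hl]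
    exact h₂
  · exact (hCi.lift_fst _ _ _).symm

lemma map [i.Full] [i.Faithful] {A B : E} (m : A ⟶ B) [StrongMono m] :
    IsClosedMono adj (i.map m) := by
  refine ⟨A, m ≫ inv (adj.counit.app B), 𝟙 _, strongMono_comp _ _, ?_⟩
  have e : adj.unit.app (i.obj B) = i.map (inv (adj.counit.app B)) := by
    rw [← cancel_mono (i.map (adj.counit.app B)), adj.right_triangle_components, ← i.map_comp]
    simp
  have : IsIso (adj.unit.app (i.obj B)) := by
    rw [e]
    infer_instance
  exact IsPullback.of_vert_isIso ⟨by rw [e, i.map_comp, Category.id_comp]⟩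

lemma id (X : S) : IsClosedMono adj (𝟙 X) :=
  ⟨L.obj X, 𝟙 _, adj.unit.app X, inferInstance, IsPullback.of_horiz_isIso ⟨by simp⟩⟩

/-- The closure of a monomorphism, formed by means of an image factorization in the subcategory,
pulls back to any closed pullback of that monomorphism. -/
lemma exists_isPullback_closure [HasFiniteLimits E]
    (hE : ∀ X : E, IsCartesianClosed (Over X)) (hL : IsQuasiLex L)
    {X Y Z X' Y' : S} {C : E} {m : X ⟶ Y} {e : L.obj X ⟶ C} {n : C ⟶ L.obj Y} [Epi e]
    [StrongMono n] (fac : e ≫ n = L.map m) {c : Z ⟶ Y} {z : Z ⟶ i.obj C}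
    (hZ : IsPullback c z (adj.unit.app Y) (i.map n)) {m' : X' ⟶ Y'} {q : X' ⟶ X} {f : Y' ⟶ Y}
    (hX : IsPullback m' q f m) (hm : IsClosedMono adj m') : ∃ r : X' ⟶ Z, IsPullback m' r f c := by
  have := adj.rightAdjoint_preservesLimits
  have : StrongMono (i.map n) := strongMono_map_of_adjunction adj n
  have : StrongMono m' := hm.strongMono
  have : StrongMono c := strongMono_of_isPullback hZ
  obtain ⟨C₀, n₀, a₀, _, hn₀⟩ := hm
  let s : X ⟶ Z := hZ.lift m (adj.unit.app X ≫ i.map e) (by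
    rw [Category.assoc, ← i.map_comp, fac]
    exact adj.unit.naturality m)
  have hs : s ≫ c = m := hZ.lift_fst _ _ _
  have hC := IsPullback.of_hasPullback (L.map f) n
  let k : L.obj X' ⟶ pullback (L.map f) n := hC.lift (L.map m') (L.map q ≫ e) (by
    rw [Category.assoc, fac, ← L.map_comp, ← L.map_comp, hX.w])
  have hk : k ≫ pullback.fst _ _ = L.map m' := hC.lift_fst _ _ _
  have hP := IsPullback.of_hasPullback (pullback.snd (L.map f) n) e
  have : Epi (pullback.fst (pullback.snd (L.map f) n) e) := epi_fst_of_isPullback hE hP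
  have hPC := hP.flip.paste_vert hC.flip
  rw [fac] at hPC
  let k' : L.obj X' ⟶ pullback (pullback.snd (L.map f) n) e :=
    hP.lift k (L.map q) (hC.lift_snd _ _ _)
  -- `k'` is a quasi-lex comparison map; `k` is `k'` followed by a pullback of the epimorphism `e`.
  have : Epi k' := by
    refine hL.epi_lift hX hPC.flip k' ?_ (hP.lift_snd _ _ _)
    rw [← Category.assoc, hP.lift_fst, hk]
  have : Epi k := by
    have : k' ≫ pullback.fst _ _ = k := hP.lift_fst _ _ _
    rw [← this]
    infer_instance
  let α : L.obj X' ⟶ C₀ := (adj.homEquiv _ _).symm a₀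
  have hα : α ≫ n₀ = L.map m' := by
    apply (adj.homEquiv _ _).injective
    rw [Adjunction.homEquiv_naturality_right]
    simp only [α, Equiv.apply_symm_apply, ← hn₀.w]
    rw [adj.homEquiv_unit]
    exact adj.unit.naturality m'
  -- The lift of the epimorphism `k` against the strong monomorphism `n₀` carries the pulled-back
  -- closure into `C₀`, hence into `X'`.
  have sq : CommSq α k n₀ (pullback.fst (L.map f) n) := ⟨hα.trans hk.symm⟩
  have hCi := hC.map i
  refine ⟨q ≫ s, ⟨⟨by rw [Category.assoc, hs, hX.w]⟩, ⟨PullbackCone.IsLimit.mk _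
    (fun t ↦ hn₀.lift t.fst (hCi.lift (t.fst ≫ adj.unit.app Y') (t.snd ≫ z) ?_ ≫ i.map sq.lift) ?_)
    ?_ ?_ ?_⟩⟩⟩
  · rw [Category.assoc, Category.assoc, ← hZ.w, ← t.condition_assoc]
    exact congrArg (t.fst ≫ ·) (adj.unit.naturality f).symm
  · rw [Category.assoc, ← i.map_comp, sq.fac_right, hCi.lift_fst]
  · intro t
    exact hn₀.lift_fst _ _ _
  · intro t
    have hqs : (q ≫ s) ≫ c = m' ≫ f := by rw [Category.assoc, hs, hX.w]
    rw [← cancel_mono c, Category.assoc _ (q ≫ s) c, hqs, hn₀.lift_fst_assoc, t.condition]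
  · intro t l h₁ _
    rw [← cancel_mono m', h₁, hn₀.lift_fst]

end IsClosedMono

/-- A reflective subcategory of a quasitopos has a classifier for strong subobjects, if it is
locally cartesian closed and the reflection is quasi-lex. -/
lemma exists_isWeakSubobjectClassifier [i.Full] [i.Faithful] (adj : L ⊣ i) [HasFiniteLimits S]
    [HasFiniteLimits E] [HasPushouts E] (hE : ∀ X : E, IsCartesianClosed (Over X))
    (hL : IsQuasiLex L) {T Ω : S} {t : T ⟶ Ω} (ht : IsWeakSubobjectClassifier t) :
    ∃ (T' Ω' : E) (t' : T' ⟶ Ω'), IsWeakSubobjectClassifier t' := by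
  have := adj.rightAdjoint_preservesLimits
  obtain ⟨hT⟩ := ht.isTerminal
  have ht_uniq {X Y : S} {m : X ⟶ Y} [StrongMono m] {g g' : X ⟶ T} {f f' : Y ⟶ Ω}
      (h : IsPullback m g f t) (h' : IsPullback m g' f' t) : f = f' :=
    (ht.existsUnique m).unique ⟨g, h⟩ ⟨g', h'⟩
  have : Mono t := hT.mono_from t
  obtain ⟨C, e, n, _, _, fac⟩ := exists_epi_strongMono_fac hE (L.map t)
  have := strongMono_map_of_adjunction adj n
  have hZ := IsPullback.of_hasPullback (adj.unit.app Ω) (i.map n)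
  let c := pullback.fst (adj.unit.app Ω) (i.map n)
  have hc : IsClosedMono adj c := ⟨C, n, _, inferInstance, hZ⟩
  have := hc.strongMono
  obtain ⟨j, ⟨gc, hj⟩, -⟩ := ht.existsUnique c
  -- The same `m` is a pullback of both `t` and its closure `c`, so `f` and `f ≫ j` classify the
  -- same subobject.
  have stable {X Y : S} {m : X ⟶ Y} (hm : IsClosedMono adj m) {g : X ⟶ T} {f : Y ⟶ Ω}
      (h : IsPullback m g f t) : f ≫ j = f := by
    obtain ⟨r, hr⟩ := hm.exists_isPullback_closure hE hL fac hZ h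
    have := hm.strongMono
    exact ht_uniq (hr.paste_vert hj) h
  let ι := equalizer.ι j (𝟙 Ω)
  have hι : ι ≫ j = ι := (equalizer.condition j (𝟙 Ω)).trans (Category.comp_id _)
  have hU := IsPullback.of_hasPullback ι c
  have hUc : IsClosedMono adj (pullback.fst ι c) := hc.of_isPullback hU
  have hUt := hU.paste_vert hj
  rw [hι] at hUt
  have := hUc.strongMono
  obtain ⟨C₀, n₀, a₀, _, hn₀⟩ := hUc
  have := strongMono_map_of_adjunction adj n₀
  obtain ⟨χ, ⟨g₀, hχ⟩, -⟩ := ht.existsUnique (i.map n₀)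
  have hηχ : adj.unit.app _ ≫ χ = ι := ht_uniq (hn₀.paste_vert hχ) hUt
  have hχj : χ ≫ j = χ := stable (.map n₀) hχ
  -- Since `χ` extends `ι` along the unit and is fixed by `j`, it yields a retraction of the unit,
  -- so the equalizer lies in the subcategory.
  let r : i.obj (L.obj _) ⟶ equalizer j (𝟙 Ω) :=
    equalizer.lift χ (hχj.trans (Category.comp_id χ).symm)
  have hr : r ≫ ι = χ := equalizer.lift_ι _ _
  have hηr : adj.unit.app _ ≫ r = 𝟙 _ := by
    rw [← cancel_mono ι, Category.assoc, hr, Category.id_comp]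
    exact hηχ
  have := isIso_unit_of_retraction adj r hηr
  have : IsIso r := by
    rw [← IsIso.inv_eq_of_hom_inv_id hηr]
    infer_instance
  have : Mono χ := by
    rw [← hr]
    infer_instance
  have exists_fac {Y : S} (f : Y ⟶ Ω) (hf : f ≫ j = f) :
      ∃ f' : Y ⟶ i.obj (L.obj (equalizer j (𝟙 Ω))), f' ≫ χ = f :=
    ⟨equalizer.lift f (hf.trans (Category.comp_id f).symm) ≫ adj.unit.app _,
      (Category.assoc _ _ _).trans ((congrArg (_ ≫ ·) hηχ).trans (equalizer.lift_ι _ _))⟩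
  have hT' : IsTerminal (i.obj (⊤_ E)) := terminalIsTerminal.isTerminalObj i _
  -- `t` classifies the identity of `T`, which is closed, so `t` factors through the fixed part of
  -- `Ω`.
  obtain ⟨t₀, ht₀⟩ := exists_fac t (stable (.id T) (IsKernelPair.id_of_mono t))
  let τ : i.obj (⊤_ E) ⟶ T := hT.from _
  have hτ : IsPullback (i.map (i.preimage (τ ≫ t₀))) τ χ t := by
    rw [i.map_preimage]
    refine ⟨⟨by rw [Category.assoc, ht₀]⟩, ⟨PullbackCone.IsLimit.mk _ (fun s ↦ hT'.from _) ?_ ?_ ?_⟩⟩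
    · intro s
      rw [← cancel_mono χ, Category.assoc, Category.assoc, ht₀, s.condition, ← Category.assoc]
      congr 1
      exact hT.hom_ext _ _
    · intro s
      exact hT.hom_ext _ _
    · intro s l _ _
      exact hT'.hom_ext _ _
  refine ⟨⊤_ E, L.obj (equalizer j (𝟙 Ω)), i.preimage (τ ≫ t₀), ⟨terminalIsTerminal⟩, ?_⟩
  intro A B m _
  have := strongMono_map_of_adjunction adj m
  obtain ⟨f, ⟨g, hf⟩, -⟩ := ht.existsUnique (i.map m)
  obtain ⟨f', hf'⟩ := exists_fac f (stable (.map m) hf)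
  refine ⟨i.preimage f', ⟨terminal.from A, ?_⟩, ?_⟩
  · have h : IsPullback (i.map m) (i.map (terminal.from A)) (i.map (i.preimage f'))
        (i.map (i.preimage (τ ≫ t₀))) := by
      refine IsPullback.of_bot ?_ ?_ hτ
      · rw [i.map_preimage, hf', hT.hom_ext (i.map (terminal.from A) ≫ τ) g]
        exact hf
      · rw [← cancel_mono χ, Category.assoc, Category.assoc, hτ.w, i.map_preimage, hf', hf.w,
          ← Category.assoc]
        congr 1
        exact hT.hom_ext _ _
    exact h.of_map i (i.map_injective (by simpa only [i.map_comp] using h.w))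
  · rintro f'' ⟨g'', h''⟩
    apply i.map_injective
    rw [i.map_preimage, ← cancel_mono χ, hf']
    exact ht_uniq ((h''.map i).paste_vert hτ) hf

end Classifier

/-! ### Quasi-lexness from preservation of products and monomorphisms -/

section QuasiLex

variable {S : Type u₁} [Category.{v₁} S] {E : Type u₂} [Category.{v₂} E]
  {L : S ⥤ E} {i : E ⥤ S}

/-- A functor preserving finite products and monomorphisms preserves jointly monic pairs. -/
lemma map_hom_ext_of_mono_prod_lift [HasBinaryProducts S] [PreservesFiniteProducts L]
    [L.PreservesMonomorphisms] {R X Y : S} (p : R ⟶ X) (q : R ⟶ Y) [Mono (prod.lift p q)]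
    {Z : E} {x y : Z ⟶ L.obj R} (hp : x ≫ L.map p = y ≫ L.map p)
    (hq : x ≫ L.map q = y ≫ L.map q) : x = y := by
  rw [← cancel_mono (L.map (prod.lift p q))]
  have h := mapIsLimitOfPreservesOfIsLimit L _ _ (prodIsProd X Y)
  apply BinaryFan.IsLimit.hom_ext h
  · change (x ≫ L.map _) ≫ L.map prod.fst = (y ≫ L.map _) ≫ L.map prod.fst
    rwa [Category.assoc, Category.assoc, ← L.map_comp, prod.lift_fst]
  · change (x ≫ L.map _) ≫ L.map prod.snd = (y ≫ L.map _) ≫ L.map prod.snd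
    rwa [Category.assoc, Category.assoc, ← L.map_comp, prod.lift_snd]

lemma mono_prod_lift_of_isPullback {C : Type u₁} [Category.{v₁} C] [HasBinaryProducts C]
    {R X Y B : C} {p : R ⟶ X} {q : R ⟶ Y} {f : X ⟶ B} {g : Y ⟶ B} (h : IsPullback p q f g) :
    Mono (prod.lift p q) where
  right_cancellation a b hab := by
    apply h.hom_ext
    · rw [← prod.lift_fst p q, reassoc_of% hab]
    · rw [← prod.lift_snd p q, reassoc_of% hab]

/-- If a reflection preserves finite products and monomorphisms, and identifies two parallel
morphisms, then it sends their equalizer to an epimorphism. -/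
lemma epi_map_of_isLimit_fork [i.Full] [i.Faithful] (adj : L ⊣ i) [HasFiniteLimits S]
    [HasPushouts S] (hS : ∀ X : S, IsCartesianClosed (Over X)) [PreservesFiniteProducts L]
    [L.PreservesMonomorphisms] {P Q : S} (a b : P ⟶ Q) (hab : L.map a = L.map b) :
    Epi (L.map (equalizer.ι a b)) := by
  have hR := IsPullback.of_hasPullback (adj.unit.app Q) (adj.unit.app Q)
  have := mono_prod_lift_of_isPullback hR
  let p₁ : pullback (adj.unit.app Q) (adj.unit.app Q) ⟶ Q :=
    pullback.fst (adj.unit.app Q) (adj.unit.app Q)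
  let p₂ : pullback (adj.unit.app Q) (adj.unit.app Q) ⟶ Q :=
    pullback.snd (adj.unit.app Q) (adj.unit.app Q)
  let δ : Q ⟶ pullback (adj.unit.app Q) (adj.unit.app Q) := hR.lift (𝟙 Q) (𝟙 Q) rfl
  have hδ₁ : δ ≫ p₁ = 𝟙 Q := hR.lift_fst _ _ _
  have hδ₂ : δ ≫ p₂ = 𝟙 Q := hR.lift_snd _ _ _
  have hp : L.map p₁ = L.map p₂ := by
    apply (adj.homEquiv _ _).injective
    rw [adj.homEquiv_unit, adj.homEquiv_unit]
    exact (adj.unit.naturality p₁).symm.trans (hR.w.trans (adj.unit.naturality p₂))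
  -- Joint monicity of `p₁` and `p₂` survives `L`, so the reflected diagonal is invertible and its
  -- cokernel pair collapses.
  have hpδ : L.map p₁ ≫ L.map δ = 𝟙 _ := by
    apply map_hom_ext_of_mono_prod_lift (L := L) p₁ p₂
    · rw [Category.assoc, ← L.map_comp, hδ₁, L.map_id, Category.comp_id, Category.id_comp]
    · rw [Category.assoc, ← L.map_comp, hδ₂, L.map_id, Category.comp_id, Category.id_comp, hp]
  have hK := IsPushout.of_hasPushout δ δ
  have hLK : L.map (pushout.inl δ δ) = L.map (pushout.inr δ δ) := by
    rw [← Category.id_comp (L.map (pushout.inl δ δ)), ← hpδ, Category.assoc, ← L.map_comp, hK.w,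
      L.map_comp, reassoc_of% hpδ]
  let κ := hK.desc (𝟙 _) (𝟙 _) rfl
  have hl : pushout.inl δ δ ≫ κ = 𝟙 _ := hK.inl_desc _ _ _
  have hr : pushout.inr δ δ ≫ κ = 𝟙 _ := hK.inr_desc _ _ _
  let f : P ⟶ pullback (adj.unit.app Q) (adj.unit.app Q) := hR.lift a b (by
    have h₁ := adj.unit.naturality a
    have h₂ := adj.unit.naturality b
    simp only [Functor.id_map, Functor.comp_map] at h₁ h₂
    rw [h₁, h₂, hab])
  have hf₁ : f ≫ p₁ = a := hR.lift_fst _ _ _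
  have hf₂ : f ≫ p₂ = b := hR.lift_snd _ _ _
  have hD : IsPullback (equalizer.ι a b) (equalizer.ι a b ≫ a) f δ := by
    refine ⟨⟨?_⟩, ⟨PullbackCone.IsLimit.mk _ (fun s ↦ equalizer.lift s.fst ?_) ?_ ?_ ?_⟩⟩
    · apply hR.hom_ext
      · change (_ ≫ f) ≫ p₁ = (_ ≫ δ) ≫ p₁
        rw [Category.assoc, hf₁, Category.assoc, hδ₁, Category.comp_id]
      · change (_ ≫ f) ≫ p₂ = (_ ≫ δ) ≫ p₂
        rw [Category.assoc, hf₂, Category.assoc, hδ₂, Category.comp_id, equalizer.condition]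
    · rw [← hf₁, ← hf₂, s.condition_assoc, s.condition_assoc, hδ₁, hδ₂]
    · intro s
      exact equalizer.lift_ι _ _
    · intro s
      rw [equalizer.lift_ι_assoc, ← hf₁, s.condition_assoc, hδ₁, Category.comp_id]
    · intro s l h _
      rw [← cancel_mono (equalizer.ι a b), h, equalizer.lift_ι]
  have hN := IsPullback.of_hasPullback f κ
  have := mono_prod_lift_of_isPullback hN
  let n₁ : P ⟶ pullback f κ := hN.lift (𝟙 P) (f ≫ pushout.inl δ δ) (by simp [hl])
  let n₂ : P ⟶ pullback f κ := hN.lift (𝟙 P) (f ≫ pushout.inr δ δ) (by simp [hr])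
  have hn₁p : n₁ ≫ pullback.fst f κ = 𝟙 P := hN.lift_fst _ _ _
  have hn₂p : n₂ ≫ pullback.fst f κ = 𝟙 P := hN.lift_fst _ _ _
  have hn₁k : n₁ ≫ pullback.snd f κ = f ≫ pushout.inl δ δ := hN.lift_snd _ _ _
  have hn₂k : n₂ ≫ pullback.snd f κ = f ≫ pushout.inr δ δ := hN.lift_snd _ _ _
  -- The pulled-back cokernel pair also collapses under `L`, so maps to objects of `E` cannot
  -- separate `n₁` from `n₂`.
  have hn : L.map n₁ = L.map n₂ := by
    apply map_hom_ext_of_mono_prod_lift (L := L) (pullback.fst f κ) (pullback.snd f κ)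
    · rw [← L.map_comp, ← L.map_comp, hn₁p, hn₂p]
    · rw [← L.map_comp, ← L.map_comp, hn₁k, hn₂k, L.map_comp, L.map_comp, hLK]
  refine ⟨fun {Z} u v huv ↦ ?_⟩
  obtain ⟨h, hu, hv⟩ := exists_desc_pullback_cokernelPair (hS _) hK hl hr hD hN hn₁p hn₁k hn₂p
    hn₂k (adj.homEquiv _ _ u) (adj.homEquiv _ _ v) (by
      rw [← adj.homEquiv_naturality_left, ← adj.homEquiv_naturality_left, huv])
  apply (adj.homEquiv _ _).injective
  obtain ⟨h, rfl⟩ := (adj.homEquiv _ _).surjective h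
  rw [← hu, ← hv, ← adj.homEquiv_naturality_left, ← adj.homEquiv_naturality_left, hn]

/-- A semi-left-exact reflection preserving finite products and monomorphisms is quasi-lex. -/
lemma IsSemiLeftExact.isQuasiLex [i.Full] [i.Faithful] {adj : L ⊣ i} (h : IsSemiLeftExact adj)
    [HasFiniteLimits S] [HasPushouts S] (hS : ∀ X : S, IsCartesianClosed (Over X))
    [PreservesFiniteProducts L] [L.PreservesMonomorphisms] : IsQuasiLex L := by
  intro D _ _ X c hc d hd
  let P := ∏ᶜ X.obj
  let π : c.pt ⟶ P := Pi.lift c.π.app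
  have hπ (j : D) : π ≫ Pi.π X.obj j = c.π.app j := Pi.lift_π _ _
  have : Mono π := ⟨fun a b hab ↦ hc.hom_ext fun j ↦ by
    rw [← hπ, reassoc_of% hab]⟩
  have hLP := isLimitFanMkObjOfIsLimit L X.obj (Pi.π X.obj) (productIsProduct X.obj)
  let k := hd.lift (L.mapCone c)
  have hk (j : D) : k ≫ d.π.app j = L.map (c.π.app j) := hd.fac _ _
  let ρ : d.pt ⟶ L.obj P := Fan.IsLimit.lift hLP d.π.app
  have hρ (j : D) : ρ ≫ L.map (Pi.π X.obj j) = d.π.app j := Fan.IsLimit.fac hLP d.π.app j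
  have hkρ : k ≫ ρ = L.map π := Fan.IsLimit.hom_ext hLP _ _ fun j ↦ by
    change (k ≫ ρ) ≫ L.map (Pi.π X.obj j) = L.map π ≫ L.map (Pi.π X.obj j)
    rw [Category.assoc, hρ, hk, ← L.map_comp, hπ]
  refine ⟨?_, ?_⟩
  · have : Mono (k ≫ ρ) := by
      rw [hkρ]
      infer_instance
    exact mono_of_mono k ρ
  -- `P'` is an object of `S` over the product whose reflection is the limit in `E`.
  · have hP' := IsPullback.of_hasPullback (i.map ρ) (adj.unit.app P)
    let P' := pullback (i.map ρ) (adj.unit.app P)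
    let p : P' ⟶ i.obj d.pt := pullback.fst _ _
    let q : P' ⟶ P := pullback.snd _ _
    have : IsIso (L.map p) := h.isIso_map hP'
    let p' : L.obj P' ⟶ d.pt := (adj.homEquiv _ _).symm p
    have hp'ρ : p' ≫ ρ = L.map q := by
      apply (adj.homEquiv _ _).injective
      rw [adj.homEquiv_naturality_right, Equiv.apply_symm_apply, hP'.w, adj.homEquiv_unit]
      exact adj.unit.naturality q
    have : Epi p' := by
      simp only [p', adj.homEquiv_counit]
      infer_instance
    -- `a` and `b` express compatibility with every arrow of `D`; they become equal under `L`
    -- because `d` is a cone.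
    let A := Σ x : D × D, (x.1 ⟶ x.2)
    let Q := ∏ᶜ fun x : A ↦ X.obj x.1.2
    let a : P' ⟶ Q := Pi.lift fun x ↦ q ≫ Pi.π X.obj x.1.1 ≫ X.map x.2
    let b : P' ⟶ Q := Pi.lift fun x ↦ q ≫ Pi.π X.obj x.1.2
    have ha (x : A) : a ≫ Pi.π _ x = q ≫ Pi.π X.obj x.1.1 ≫ X.map x.2 := Pi.lift_π _ _
    have hb (x : A) : b ≫ Pi.π _ x = q ≫ Pi.π X.obj x.1.2 := Pi.lift_π _ _
    have hLQ := isLimitFanMkObjOfIsLimit L _ _ (productIsProduct fun x : A ↦ X.obj x.1.2)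
    have hab : L.map a = L.map b := Fan.IsLimit.hom_ext hLQ _ _ fun x ↦ by
      change L.map a ≫ L.map (Pi.π _ x) = L.map b ≫ L.map (Pi.π _ x)
      rw [← L.map_comp, ← L.map_comp, ha, hb, L.map_comp, L.map_comp, L.map_comp, ← hp'ρ,
        Category.assoc, Category.assoc, hρ, reassoc_of% (hρ x.1.1)]
      exact congrArg (p' ≫ ·) (d.w x.2)
    have := epi_map_of_isLimit_fork adj hS a b hab
    let e := equalizer.ι a b
    let l : equalizer a b ⟶ c.pt := hc.lift
      { pt := equalizer a b
        π :=
          { app j := e ≫ q ≫ Pi.π X.obj j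
            naturality j j' g := by
              have := congrArg (· ≫ Pi.π _ (⟨(j, j'), g⟩ : A)) (equalizer.condition a b)
              simp only [Category.assoc, ha, hb] at this
              simpa [e] using this.symm } }
    have hl : l ≫ π = e ≫ q := Pi.hom_ext _ _ fun j ↦ by
      rw [Category.assoc, hπ, Category.assoc]
      exact hc.fac _ _
    have hlk : L.map l ≫ k = L.map e ≫ p' := hd.hom_ext fun j ↦ by
      rw [← hρ, Category.assoc, Category.assoc, reassoc_of% hkρ, reassoc_of% hp'ρ,
        ← L.map_comp_assoc, hl, L.map_comp_assoc]
    have : Epi (L.map l ≫ k) := by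
      rw [hlk]
      exact epi_comp' this inferInstance
    exact epi_of_epi (L.map l) k

lemma HasStableUnits.isSemiLeftExact {adj : L ⊣ i} (h : HasStableUnits adj) :
    IsSemiLeftExact adj :=
  fun X A u ↦ h (L.obj X) X (i.obj A) (adj.unit.app X) u

/-- A reflection with stable units preserves finite products. -/
lemma HasStableUnits.preservesFiniteProducts [i.Full] [i.Faithful] {adj : L ⊣ i}
    (h : HasStableUnits adj) [HasFiniteLimits S] [HasTerminal E] : PreservesFiniteProducts L := by
  have := adj.rightAdjoint_preservesLimits
  let hT : IsTerminal (i.obj (⊤_ E)) := terminalIsTerminal.isTerminalObj i _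
  let hLT : IsTerminal (L.obj (i.obj (⊤_ E))) :=
    terminalIsTerminal.ofIso (asIso (adj.counit.app (⊤_ E))).symm
  have : PreservesLimit (Functor.empty S) L :=
    preservesLimit_of_preserves_limit_cone hT ((isLimitMapConeEmptyConeEquiv L _).symm hLT)
  have : PreservesLimitsOfShape (Discrete PEmpty) L :=
    preservesLimitsOfShape_pempty_of_preservesTerminal L
  have hpair (X Y : S) : PreservesLimit (pair X Y) L := by
    have := h _ _ _ (hT.from X) (hT.from Y)
    -- A binary product is a pullback over the terminal object, which comes from `E`.
    have hP := (IsPullback.of_is_product' (prodIsProd X Y) hT).map L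
    exact preservesLimit_of_preserves_limit_cone (prodIsProd X Y)
      ((isLimitMapConeBinaryFanEquiv L _ _).symm
        (isBinaryProductOfIsTerminalIsPullback _ _ hLT _ _ hP.isLimit))
  have : PreservesLimitsOfShape (Discrete WalkingPair) L :=
    ⟨fun {K} ↦ preservesLimit_of_iso_diagram L (diagramIsoPair K).symm⟩
  exact .of_preserves_binary_and_terminal L

end QuasiLex

/-- A reflective subcategory of a quasitopos is a quasitopos if the reflection is semi-left-exact
and quasi-lex. -/
lemma IsQuasitopos.of_reflective {S : Type u₁} [Category.{v₁} S] {E : Type u₂} [Category.{v₂} E]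
    {L : S ⥤ E} {i : E ⥤ S} [i.Full] [i.Faithful] {adj : L ⊣ i} (hS : IsQuasitopos S)
    (h : IsSemiLeftExact adj) (hL : IsQuasiLex L) : IsQuasitopos E := by
  let _ : Reflective i := ⟨L, adj⟩
  have := hS.hasFiniteLimits
  have := hS.hasFiniteColimits
  have : HasFiniteLimits E := ⟨fun _ ↦ hasLimitsOfShape_of_reflective i⟩
  have : HasFiniteColimits E := ⟨fun _ ↦ hasColimitsOfShape_of_reflective i⟩
  have hE (X : E) : IsCartesianClosed (Over X) :=
    isCartesianClosed_over_of_reflective adj h X (hS.cartesianClosed_over _)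
  obtain ⟨T, Ω, t, ht⟩ := hS.exists_classifier
  exact ⟨inferInstance, inferInstance,
    isCartesianClosed_of_reflective adj hS.cartesianClosed h.isIso_map, hE,
    exists_isWeakSubobjectClassifier adj hE hL ht⟩

end QuasitoposReflection

theorem mainTheorem3 {S : Type u₁} [Category.{v₁} S] {E : Type u₂} [Category.{v₂} E]
    {L : S ⥤ E} {i : E ⥤ S} [i.Full] [i.Faithful] (adj : L ⊣ i)
    (hS : QuasitoposReflection.IsQuasitopos S) :
    (QuasitoposReflection.IsSemiLeftExact adj ∧ QuasitoposReflection.IsQuasiLex L →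
      QuasitoposReflection.IsQuasitopos E) ∧
    (QuasitoposReflection.IsSemiLeftExact adj ∧ PreservesFiniteProducts L ∧
        L.PreservesMonomorphisms →
      QuasitoposReflection.IsQuasiLex L ∧ QuasitoposReflection.IsQuasitopos E) ∧
    (QuasitoposReflection.HasStableUnits adj ∧ L.PreservesMonomorphisms →
      (QuasitoposReflection.IsSemiLeftExact adj ∧ QuasitoposReflection.IsQuasiLex L) ∧
        QuasitoposReflection.IsQuasitopos E) := by
  have := hS.hasFiniteLimits
  have := hS.hasFiniteColimits
  have quasiLex (h : QuasitoposReflection.IsSemiLeftExact adj) (_ : PreservesFiniteProducts L)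
      (_ : L.PreservesMonomorphisms) : QuasitoposReflection.IsQuasiLex L :=
    h.isQuasiLex hS.cartesianClosed_over
  refine ⟨fun ⟨h, hL⟩ ↦ hS.of_reflective h hL, fun ⟨h, hp, hm⟩ ↦ ?_, fun ⟨h, hm⟩ ↦ ?_⟩
  · exact ⟨quasiLex h hp hm, hS.of_reflective h (quasiLex h hp hm)⟩
  · let _ : Reflective i := ⟨L, adj⟩
    have : HasTerminal E := hasLimitsOfShape_of_reflective i
    have hL := quasiLex h.isSemiLeftExact h.preservesFiniteProducts hm
    exact ⟨⟨h.isSemiLeftExact, hL⟩, hS.of_reflective h.isSemiLeftExact hL⟩
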